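/- Let $a,b,c,d$ be positive integers, let $V=\{(x,y,z)\in\mathbb R^3 : y^a=z^bx^c+x^d\}$, and let $Oz=\{x=y=0\}$ be the $z$-axis. Then $V\setminus Oz$ is a smooth $2$-dimensional submanifold of $\mathbb R^3$, $Oz$ is a smooth $1$-dimensional submanifold, and $0\in Oz\cap\overline{V\setminus Oz}$. The pair $(V\setminus Oz,\,Oz)$ is Whitney $(b)$-regular at $0$ if for all sequences $p_i\in V\setminus Oz$ and $q_i\in Oz$ converging to $0$ such that the tangent planes $T_{p_i}(V\setminus Oz)$ converge to a plane $\alpha$ and the unit vectors $(q_i-p_i)/|q_i-p_i|$ converge to a vector $\lambda$, one has $\lambda\in\alpha$. This holds exactly according to the following decision tree (yes = regular at $0$, no = not regular at $0$): 1. If $a=1$: yes. Otherwise ($a>1$) continue. 2. If $d\le c$: yes. Otherwise ($d>c$) continue. 3. If $b$ is odd: no. If $b$ is even and $d\not\equiv c \pmod 2$: no. Otherwise ($b$ even and $d\equiv c\pmod 2$) continue. 4. If $d<a$: yes when $d<b+c$, and no when $d\ge b+c$. 5. If $a\le d$ and $a>c$: no. 6. If $a\le d$ and $a\le c$: - if $d<b+c$: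 yes; - if $d\ge b+c$ and $a\le b$: yes; - if $d\ge b+c$ and $a>b$: yes when $d<\frac{ac}{a-b}$, and no when $d\ge\frac{ac}{a-b}$. -/

import Mathlib

open Filter Topology
open scoped ContDiff

noncomputable section

namespace Whitney

variable {E : Type*} [NormedAddCommGroup E] [InnerProductSpace ℝ E]

/-- `X` is a smooth (`C^∞`, not necessarily closed) embedded submanifold of dimension `m` of the
finite-dimensional space `E`: near each of its points it is the zero set of a smooth submersion
to `ℝ^k`, where `k = dim E - m`. -/
def IsSmoothSubmanifold (m : ℕ) (X : Set E) : Prop :=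
  ∃ k : ℕ, Module.finrank ℝ E = m + k ∧
    ∀ p ∈ X, ∃ (U : Set E) (g : E → EuclideanSpace ℝ (Fin k)),
      IsOpen U ∧ p ∈ U ∧ ContDiffOn ℝ ∞ g U ∧
      (∀ q ∈ U, Function.Surjective (fderiv ℝ g q)) ∧
      X ∩ U = {q ∈ U | g q = 0}

/-- The tangent space `T_p X ⊆ E` of a subset `X` at `p`: the velocities at time `0` of the curves
in `X` through `p` that are differentiable at time `0`. If `X` is a smooth submanifold and
`p ∈ X`, these velocities already form a linear subspace, so that the span adds nothing. -/
def tangentSpaceAt (X : Set E) (p : E) : Submodule ℝ E :=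
  Submodule.span ℝ {v : E | ∃ γ : ℝ → E,
    γ 0 = p ∧ (∀ᶠ t in 𝓝 (0 : ℝ), γ t ∈ X) ∧ HasDerivAt γ v 0}

/-- Convergence of a sequence of linear subspaces of `E` in the Grassmannian: the orthogonal
projections onto them converge in operator norm. -/
def SubspaceTendsto [FiniteDimensional ℝ E] (τ : ℕ → Submodule ℝ E) (α : Submodule ℝ E) : Prop :=
  Tendsto (fun i => (τ i).starProjection) atTop (𝓝 α.starProjection)

/-- Whitney's condition (b) for the pair `(X, Y)` at the point `y₀`. -/
def IsBRegularAt [FiniteDimensional ℝ E] (X Y : Set E) (y₀ : E) : Prop :=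
  ∀ (x y : ℕ → E) (α : Submodule ℝ E) (l : E),
    (∀ i, x i ∈ X) → (∀ i, y i ∈ Y) →
    Tendsto x atTop (𝓝 y₀) → Tendsto y atTop (𝓝 y₀) →
    SubspaceTendsto (fun i => tangentSpaceAt X (x i)) α →
    Tendsto (fun i => ‖y i - x i‖⁻¹ • (y i - x i)) atTop (𝓝 l) →
    l ∈ α

/-- The real algebraic surface `y^a = z^b x^c + x^d` in `ℝ³`, with coordinates
`x = p 0`, `y = p 1`, `z = p 2`. -/
def surface (a b c d : ℕ) : Set (EuclideanSpace ℝ (Fin 3)) :=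
  {p | p 1 ^ a = p 2 ^ b * p 0 ^ c + p 0 ^ d}

/-- The `z`-axis `Oz` in `ℝ³`. -/
def zAxis : Set (EuclideanSpace ℝ (Fin 3)) :=
  {p | p 0 = 0 ∧ p 1 = 0}

end Whitney

end

/-! Write `f = y^a - z^b x^c - x^d` and `X = V \ Oz`. On `V`, `x = 0` forces `y = 0`, so `X = V ∩ {x
≠ 0}`, and there the gradient `n` of `f` does not vanish. Since `X` has codimension one, compactness
of the unit sphere turns condition (b) into `⟪n, q - p⟫ = o(‖n‖ ‖q - p‖)`
(`isBRegularAt_iff_isLittleO`). Moving `q` along `Oz` splits this into two conditions on `X` near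
`0` (`isBRegularAt_stratum_iff`): (i) `f_z = o(|f_x| + |f_y|)`; (ii) `x f_x + y f_y = o((|f_x| +
|f_y|)(|x| + |y|))`.

For `a = 1` the surface is a graph; for `d ≤ c` the term `x^d` dominates. Both are regular. For `c <
d` and `a > 1`, an odd `b` or `d - c` gives a curve in `X ∩ {y = 0}` that violates (ii). If both are
even, `z^b + x^(d-c)` has no cancellation, so `x f_x`, `y f_y` and `y^a` have the same order, and
(ii) holds once `x` and `y` have different orders (`d < a` or `a ≤ c`). If `c < a ≤ d`, a curve with
`y` comparable to `x` violates (ii). Condition (i) follows from monomial inequalities in `S = z^b +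
x^(d-c)`, by comparing `f_z` with `f_x` when `d < b + c` and with `f_y` otherwise; it fails along
`z^b = x^(d-c)` when `b + c ≤ d` and `b d ≤ a (d - c)`. -/

noncomputable section

namespace Whitney

open Asymptotics Set
open scoped InnerProductSpace

/-! ### Condition (b) for hypersurfaces in terms of a normal field -/

section General

variable {E : Type*} [NormedAddCommGroup E] [InnerProductSpace ℝ E]

/-- The tangent space of a regular level set of a scalar function is the orthogonal complement of
the gradient. -/
theorem tangentSpaceAt_eq_orthogonal [CompleteSpace E] {X U : Set E} {f : E → ℝ} {p n : E}
    (hf : HasStrictFDerivAt f (innerSL ℝ n) p) (hn : n ≠ 0) (hU : U ∈ 𝓝 p)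
    (hX : X ∩ U = {q ∈ U | f q = 0}) (hp : p ∈ X) :
    tangentSpaceAt X p = (ℝ ∙ n)ᗮ := by
  have hpU : p ∈ U := mem_of_mem_nhds hU
  have hfp : f p = 0 := by
    have : p ∈ X ∩ U := ⟨hp, hpU⟩
    rw [hX] at this
    exact this.2
  apply le_antisymm
  · refine Submodule.span_le.2 ?_
    rintro v ⟨γ, hγ0, hγX, hγ⟩
    rw [SetLike.mem_coe, Submodule.mem_orthogonal_singleton_iff_inner_right]
    have h1 : HasDerivAt (f ∘ γ) (innerSL ℝ n v) 0 := by
      refine HasFDerivAt.comp_hasDerivAt (0 : ℝ) ?_ hγ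
      rw [hγ0]
      exact hf.hasFDerivAt
    have h2 : f ∘ γ =ᶠ[𝓝 0] fun _ => (0 : ℝ) := by
      have hγU : ∀ᶠ t in 𝓝 (0 : ℝ), γ t ∈ U := by
        refine hγ.continuousAt.eventually_mem ?_
        rwa [hγ0]
      filter_upwards [hγX, hγU] with t ht htU
      have : γ t ∈ X ∩ U := ⟨ht, htU⟩
      rw [hX] at this
      exact this.2
    have h3 := (h1.congr_of_eventuallyEq h2.symm).unique (hasDerivAt_const (0 : ℝ) (0 : ℝ))
    simpa using h3
  · intro v hv
    rw [Submodule.mem_orthogonal_singleton_iff_inner_right] at hv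
    refine Submodule.subset_span ?_
    have hr : (innerSL ℝ n : E →ₗ[ℝ] ℝ).range = ⊤ := by
      refine LinearMap.range_eq_top.2 (LinearMap.surjective ?_)
      intro h0
      have := LinearMap.congr_fun h0 n
      simp [hn] at this
    let w : (innerSL ℝ n : E →ₗ[ℝ] ℝ).ker := ⟨v, by simpa using hv⟩
    have hw0 : (0 : ℝ) • w = 0 := zero_smul ℝ w
    have hw : Tendsto (fun t : ℝ => t • w) (𝓝 0) (𝓝 0) := by
      have h1 : Continuous fun t : ℝ => t • w := by fun_prop
      have h2 := h1.tendsto 0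
      rwa [hw0] at h2
    -- The implicit function parametrizes the level set by the kernel of `⟪n, ·⟫`; its derivative at
    -- `0` is the inclusion, so `t ↦ t • w` is sent to a curve with velocity `v`.
    refine ⟨fun t => hf.implicitFunction f _ hr (f p) (t • w), ?_, ?_, ?_⟩
    · change hf.implicitFunction f _ hr (f p) ((0 : ℝ) • w) = p
      rw [hw0]
      exact hf.implicitFunction_apply_image hr
    · have h1 := (tendsto_const_nhds (x := f p)).prodMk_nhds hw
      have h2 := h1.eventually (hf.map_implicitFunction_eq hr)
      have h3 := hf.tendsto_implicitFunction hr (tendsto_const_nhds (x := f p)) hw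
      filter_upwards [h2, h3.eventually hU] with t ht htU
      have : hf.implicitFunction f _ hr (f p) (t • w) ∈ X ∩ U := by
        rw [hX]
        exact ⟨htU, ht.trans hfp⟩
      exact this.1
    · have h1 : HasDerivAt (fun t : ℝ => t • w) w 0 := by
        have := (hasDerivAt_id (0 : ℝ)).smul_const w
        rwa [one_smul] at this
      have h2 := (hf.to_implicitFunction hr).hasFDerivAt
      have h3 : HasFDerivAt (hf.implicitFunction f _ hr (f p))
          (innerSL ℝ n : E →ₗ[ℝ] ℝ).ker.subtypeL ((0 : ℝ) • w) := by rwa [hw0]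
      exact h3.comp_hasDerivAt (0 : ℝ) h1

theorem starProjection_orthogonal_singleton_apply (n v : E) :
    (ℝ ∙ n)ᗮ.starProjection v = v - ⟪‖n‖⁻¹ • n, v⟫_ℝ • (‖n‖⁻¹ • n) := by
  rw [Submodule.starProjection_orthogonal]
  simp only [sub_apply, ContinuousLinearMap.id_apply,
    Submodule.starProjection_singleton, real_inner_smul_left, smul_smul]
  congr 2
  simp only [RCLike.ofReal_real_eq_id, id_eq]
  ring

/-- Whitney's condition (b) for a stratum of codimension one, in terms of a normal field. -/
theorem isBRegularAt_iff_isLittleO [FiniteDimensional ℝ E] {X Y : Set E} {y₀ : E} {n : E → E}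
    (hn : ∀ p ∈ X, n p ≠ 0) (hT : ∀ p ∈ X, tangentSpaceAt X p = (ℝ ∙ n p)ᗮ)
    (hXY : Disjoint X Y) :
    IsBRegularAt X Y y₀ ↔
      (fun r : E × E => ⟪n r.1, r.2 - r.1⟫_ℝ) =o[𝓝[X ×ˢ Y] (y₀, y₀)]
        fun r => ‖n r.1‖ * ‖r.2 - r.1‖ := by
  have hproj : ∀ p ∈ X, ∀ v, (tangentSpaceAt X p).starProjection v =
      v - ⟪‖n p‖⁻¹ • n p, v⟫_ℝ • (‖n p‖⁻¹ • n p) := by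
    intro p hp v
    rw [← starProjection_orthogonal_singleton_apply]
    congr 2
    exact hT p hp
  constructor
  · intro h
    rw [isLittleO_iff]
    by_contra! hcon
    obtain ⟨ε, hε, hfr⟩ := hcon
    have hfr' := hfr.and_eventually (self_mem_nhdsWithin (s := X ×ˢ Y) (a := (y₀, y₀)))
    obtain ⟨r, hr, hrp⟩ := exists_seq_forall_of_frequently hfr'
    have hrX : ∀ i, (r i).1 ∈ X := fun i => (hrp i).2.1
    have hrY : ∀ i, (r i).2 ∈ Y := fun i => (hrp i).2.2
    have hne : ∀ i, (r i).2 - (r i).1 ≠ 0 := fun i h0 =>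
      Set.disjoint_left.1 hXY (hrX i) (sub_eq_zero.1 h0 ▸ hrY i)
    have hr' : Tendsto r atTop (𝓝 (y₀, y₀)) := hr.mono_right nhdsWithin_le_nhds
    let N : ℕ → E := fun i => ‖n (r i).1‖⁻¹ • n (r i).1
    let w : ℕ → E := fun i => ‖(r i).2 - (r i).1‖⁻¹ • ((r i).2 - (r i).1)
    have hNw : ∀ i, (N i, w i) ∈ Metric.sphere (0 : E) 1 ×ˢ Metric.sphere (0 : E) 1 := by
      intro i
      simp only [Set.mem_prod, mem_sphere_zero_iff_norm]
      exact ⟨norm_smul_inv_norm (𝕜 := ℝ) (hn _ (hrX i)), norm_smul_inv_norm (𝕜 := ℝ) (hne i)⟩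
    have hε' : ∀ i, ε ≤ |⟪N i, w i⟫_ℝ| := by
      intro i
      have h1 := (hrp i).1
      have hn0 : 0 < ‖n (r i).1‖ := norm_pos_iff.2 (hn _ (hrX i))
      have hw0 : 0 < ‖(r i).2 - (r i).1‖ := norm_pos_iff.2 (hne i)
      simp only [N, w, real_inner_smul_left, real_inner_smul_right, abs_mul, abs_inv, abs_norm]
      rw [← mul_assoc, ← mul_inv, inv_mul_eq_div, le_div_iff₀ (by positivity)]
      rw [Real.norm_eq_abs, Real.norm_eq_abs, abs_mul, abs_norm, abs_norm] at h1
      linarith [mul_comm ‖n (r i).1‖ ‖(r i).2 - (r i).1‖]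
    -- After passing to a subsequence, unit normals and unit secants both converge, so (b) applies
    -- and forces `⟪N₀, l⟫ = 0`, against the lower bound `ε`.
    obtain ⟨⟨N₀, l⟩, hmem, φ, hφ, hlim⟩ :=
      ((isCompact_sphere (0 : E) 1).prod (isCompact_sphere (0 : E) 1)).tendsto_subseq hNw
    have hlimN : Tendsto (fun i => N (φ i)) atTop (𝓝 N₀) := (continuous_fst.tendsto _).comp hlim
    have hlimw : Tendsto (fun i => w (φ i)) atTop (𝓝 l) := (continuous_snd.tendsto _).comp hlim
    have hN₀ : ‖N₀‖ = 1 := by simpa using hmem.1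
    have hl : l ∈ (ℝ ∙ N₀)ᗮ := by
      refine h (fun i => (r (φ i)).1) (fun i => (r (φ i)).2) _ l (fun i => hrX _)
        (fun i => hrY _) ?_ ?_ ?_ hlimw
      · exact ((continuous_fst.tendsto _).comp hr').comp hφ.tendsto_atTop
      · exact ((continuous_snd.tendsto _).comp hr').comp hφ.tendsto_atTop
      -- For unit `m`, `G m` is the projection onto `m`'s orthogonal complement; its continuity in
      -- `m` turns convergence of normals into convergence of planes.
      · let G : E → (E →L[ℝ] E) := fun m =>
          ContinuousLinearMap.id ℝ E - (innerSL ℝ m).smulRight m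
        have hG : Continuous G := by
          refine continuous_const.sub ?_
          exact ((ContinuousLinearMap.smulRightL ℝ E E).continuous.comp
            (innerSL ℝ).continuous).clm_apply continuous_id
        have h1 : (ℝ ∙ N₀)ᗮ.starProjection = G N₀ := by
          ext v
          rw [starProjection_orthogonal_singleton_apply]
          simp [G, hN₀]
        have h2 : ∀ i, (tangentSpaceAt X (r (φ i)).1).starProjection = G (N (φ i)) := by
          intro i
          ext v
          rw [hproj _ (hrX _)]
          simp [G, N, real_inner_smul_left]
        unfold SubspaceTendsto
        simp only [h1, h2]
        exact (hG.tendsto _).comp hlimN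
    rw [Submodule.mem_orthogonal_singleton_iff_inner_right] at hl
    have h3 : Tendsto (fun i => |⟪N (φ i), w (φ i)⟫_ℝ|) atTop (𝓝 |⟪N₀, l⟫_ℝ|) :=
      (hlimN.inner hlimw).abs
    rw [hl, abs_zero] at h3
    exact absurd (ge_of_tendsto' h3 fun i => hε' (φ i)) (not_le.2 hε)
  · intro h x y α l hx hy hxt hyt hα hl
    have hr : Tendsto (fun i => (x i, y i)) atTop (𝓝[X ×ˢ Y] (y₀, y₀)) :=
      tendsto_nhdsWithin_iff.2 ⟨hxt.prodMk_nhds hyt, .of_forall fun i => ⟨hx i, hy i⟩⟩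
    let N : ℕ → E := fun i => ‖n (x i)‖⁻¹ • n (x i)
    let w : ℕ → E := fun i => ‖y i - x i‖⁻¹ • (y i - x i)
    have h1 : Tendsto (fun i => ⟪N i, w i⟫_ℝ) atTop (𝓝 0) := by
      refine ((h.comp_tendsto hr).tendsto_div_nhds_zero).congr fun i => ?_
      simp only [Function.comp, N, w, real_inner_smul_left, real_inner_smul_right]
      rw [div_eq_mul_inv, mul_inv]
      ring
    have h2 : Tendsto (fun i => ⟪N i, w i⟫_ℝ • N i) atTop (𝓝 0) := by
      refine squeeze_zero_norm (fun i => ?_) (by simpa using h1.norm)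
      have hNi : ‖N i‖ = 1 := norm_smul_inv_norm (𝕜 := ℝ) (hn _ (hx i))
      rw [norm_smul, hNi, mul_one, Real.norm_eq_abs]
    -- Projecting the secant changes it only by its vanishing normal component, so `l` is fixed by
    -- the limit projection.
    have h3 : Tendsto (fun i => (tangentSpaceAt X (x i)).starProjection (w i)) atTop (𝓝 l) := by
      have : (fun i => (tangentSpaceAt X (x i)).starProjection (w i)) =
          fun i => w i - ⟪N i, w i⟫_ℝ • N i := funext fun i => hproj _ (hx i) _
      rw [this]
      simpa using hl.sub h2
    have h4 : Tendsto (fun i => (tangentSpaceAt X (x i)).starProjection (w i)) atTop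
        (𝓝 (α.starProjection l)) := by
      have hev : Continuous fun u : (E →L[ℝ] E) × E => u.1 u.2 := by fun_prop
      exact (hev.tendsto _).comp (hα.prodMk_nhds hl)
    exact Submodule.starProjection_eq_self_iff.1 (tendsto_nhds_unique h4 h3)

end General

/-! ### The surface: gradient, smoothness, regularity in coordinates -/

/-- Minus the `x`-derivative of `y^a - z^b x^c - x^d`. -/
def gradX (b c d : ℕ) (p : EuclideanSpace ℝ (Fin 3)) : ℝ :=
  c * p 2 ^ b * p 0 ^ (c - 1) + d * p 0 ^ (d - 1)

/-- The `y`-derivative of `y^a - z^b x^c - x^d`. -/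
def gradY (a : ℕ) (p : EuclideanSpace ℝ (Fin 3)) : ℝ := a * p 1 ^ (a - 1)

/-- Minus the `z`-derivative of `y^a - z^b x^c - x^d`. -/
def gradZ (b c : ℕ) (p : EuclideanSpace ℝ (Fin 3)) : ℝ := b * p 2 ^ (b - 1) * p 0 ^ c

/-- The gradient of `y^a - z^b x^c - x^d`. -/
def normal (a b c d : ℕ) (p : EuclideanSpace ℝ (Fin 3)) : EuclideanSpace ℝ (Fin 3) :=
  !₂[-gradX b c d p, gradY a p, -gradZ b c p]

section Surface

variable {a b c d : ℕ}

theorem hasStrictFDerivAt_surface (a b c d : ℕ) (p : EuclideanSpace ℝ (Fin 3)) :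
    HasStrictFDerivAt (fun q : EuclideanSpace ℝ (Fin 3) => q 1 ^ a - (q 2 ^ b * q 0 ^ c + q 0 ^ d))
      (innerSL ℝ (normal a b c d p)) p := by
  have h : ∀ i : Fin 3, HasStrictFDerivAt (fun q : EuclideanSpace ℝ (Fin 3) => q i)
      (EuclideanSpace.proj i : StrongDual ℝ (EuclideanSpace ℝ (Fin 3))) p := fun i =>
    (EuclideanSpace.proj i : StrongDual ℝ (EuclideanSpace ℝ (Fin 3))).hasStrictFDerivAt
  refine (((h 1).pow a).sub ((((h 2).pow b).mul ((h 0).pow c)).add ((h 0).pow d))).congr_fderiv ?_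
  ext v
  simp [normal, gradX, gradY, gradZ, PiLp.inner_apply, Fin.sum_univ_three]
  ring

/-- Since `x ≠ 0`, a vanishing `z`-component forces `z = 0`, and then the `x`-component is `-d
x^(d-1)`. -/
theorem normal_ne_zero (hb : 0 < b) (hd : 0 < d) {p : EuclideanSpace ℝ (Fin 3)} (hp : p 0 ≠ 0) :
    normal a b c d p ≠ 0 := by
  intro h
  have h0 : gradX b c d p = 0 := by simpa [normal] using congrArg (fun v => v 0) h
  have h2 : gradZ b c p = 0 := by simpa [normal] using congrArg (fun v => v 2) h
  have hb' : (b : ℝ) ≠ 0 := by positivity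
  have hz : p 2 = 0 := by
    by_contra hz
    exact mul_ne_zero (mul_ne_zero hb' (pow_ne_zero _ hz)) (pow_ne_zero _ hp) h2
  have hd' : (d : ℝ) ≠ 0 := by positivity
  simp only [gradX, hz, zero_pow hb.ne', mul_zero, zero_mul, zero_add] at h0
  exact mul_ne_zero hd' (pow_ne_zero _ hp) h0

theorem mem_stratum_iff (ha : 0 < a) (hc : 0 < c) (hd : 0 < d) {p : EuclideanSpace ℝ (Fin 3)} :
    p ∈ surface a b c d \ zAxis ↔ p 0 ≠ 0 ∧ p 1 ^ a = p 2 ^ b * p 0 ^ c + p 0 ^ d := by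
  simp only [surface, zAxis, Set.mem_sdiff, mem_ofPred_eq]
  constructor
  · rintro ⟨h1, h2⟩
    refine ⟨fun h0 => h2 ⟨h0, ?_⟩, h1⟩
    rw [h0, zero_pow hc.ne', zero_pow hd.ne', mul_zero, add_zero] at h1
    exact (pow_eq_zero_iff ha.ne').1 h1
  · exact fun h => ⟨h.2, fun h' => h.1 h'.1⟩

theorem isOpen_setOf_ne_zero : IsOpen {p : EuclideanSpace ℝ (Fin 3) | p 0 ≠ 0} :=
  isOpen_ne_fun (by fun_prop) continuous_const

theorem stratum_inter (ha : 0 < a) (hc : 0 < c) (hd : 0 < d) :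
    (surface a b c d \ zAxis) ∩ {p | p 0 ≠ 0} =
      {q ∈ {p : EuclideanSpace ℝ (Fin 3) | p 0 ≠ 0} |
        q 1 ^ a - (q 2 ^ b * q 0 ^ c + q 0 ^ d) = 0} := by
  ext p
  rw [mem_inter_iff, mem_stratum_iff ha hc hd]
  simp only [mem_ofPred_eq, sub_eq_zero]
  tauto

theorem tangentSpaceAt_stratum (ha : 0 < a) (hb : 0 < b) (hc : 0 < c) (hd : 0 < d)
    {p : EuclideanSpace ℝ (Fin 3)} (hp : p ∈ surface a b c d \ zAxis) :
    tangentSpaceAt (surface a b c d \ zAxis) p = (ℝ ∙ normal a b c d p)ᗮ := by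
  have hp0 : p 0 ≠ 0 := ((mem_stratum_iff ha hc hd).1 hp).1
  exact tangentSpaceAt_eq_orthogonal (hasStrictFDerivAt_surface a b c d p)
    (normal_ne_zero hb hd hp0) (isOpen_setOf_ne_zero.mem_nhds hp0) (stratum_inter ha hc hd) hp

theorem isSmoothSubmanifold_stratum (ha : 0 < a) (hb : 0 < b) (hc : 0 < c) (hd : 0 < d) :
    IsSmoothSubmanifold 2 (surface a b c d \ zAxis) := by
  refine ⟨1, by simp, fun p hp => ?_⟩
  have hp0 : p 0 ≠ 0 := ((mem_stratum_iff ha hc hd).1 hp).1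
  let f : EuclideanSpace ℝ (Fin 3) → ℝ := fun q => q 1 ^ a - (q 2 ^ b * q 0 ^ c + q 0 ^ d)
  let ι : ℝ →L[ℝ] EuclideanSpace ℝ (Fin 1) :=
    (ContinuousLinearMap.id ℝ ℝ).smulRight (EuclideanSpace.single 0 1)
  refine ⟨{p | p 0 ≠ 0}, fun q => ι (f q), isOpen_setOf_ne_zero, hp0, ?_, ?_, ?_⟩
  · have hf : ContDiff ℝ ∞ f := by fun_prop
    exact (ι.contDiff.comp hf).contDiffOn
  · intro q hq
    have h1 : HasFDerivAt (fun q => ι (f q)) (ι ∘L innerSL ℝ (normal a b c d q)) q :=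
      ι.hasFDerivAt.comp q (hasStrictFDerivAt_surface a b c d q).hasFDerivAt
    rw [h1.fderiv]
    intro w
    have hn := normal_ne_zero (a := a) (c := c) hb hd hq
    -- A multiple of the gradient suffices as preimage, because `⟪n, n⟫ = ‖n‖²`.
    refine ⟨(w 0 / ‖normal a b c d q‖ ^ 2) • normal a b c d q, ?_⟩
    ext i
    fin_cases i
    have : ‖normal a b c d q‖ ≠ 0 := norm_ne_zero_iff.2 hn
    simp [ι]
    field_simp
  · rw [stratum_inter ha hc hd]
    ext q
    have : ι (f q) = 0 ↔ f q = 0 := by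
      simp [ι]
    simp only [mem_ofPred_eq, this, f]

theorem isSmoothSubmanifold_zAxis : IsSmoothSubmanifold 1 zAxis := by
  refine ⟨2, by simp, fun p _ => ?_⟩
  let g : EuclideanSpace ℝ (Fin 3) →ₗ[ℝ] EuclideanSpace ℝ (Fin 2) :=
    { toFun := fun q => !₂[q 0, q 1]
      map_add' := by intro u v; ext i; fin_cases i <;> simp
      map_smul' := by intro u v; ext i; fin_cases i <;> simp }
  let G := LinearMap.toContinuousLinearMap g
  refine ⟨univ, G, isOpen_univ, mem_univ _, G.contDiff.contDiffOn, ?_, ?_⟩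
  · intro q _
    rw [G.fderiv]
    intro w
    refine ⟨!₂[w 0, w 1, 0], ?_⟩
    ext i
    fin_cases i <;> simp [G, g]
  · ext q
    have : G q = 0 ↔ q 0 = 0 ∧ q 1 = 0 := by
      constructor
      · intro h
        exact ⟨by simpa [G, g] using congrArg (fun v => v 0) h,
          by simpa [G, g] using congrArg (fun v => v 1) h⟩
      · rintro ⟨h0, h1⟩
        ext i
        fin_cases i <;> simp [G, g, h0, h1]
    simp [zAxis, this]

theorem zero_mem_zAxis_inter_closure (ha : 0 < a) (hc : 0 < c) (hb : 0 < b) (hd : 0 < d) :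
    (0 : EuclideanSpace ℝ (Fin 3)) ∈ zAxis ∩ closure (surface a b c d \ zAxis) := by
  refine ⟨by simp [zAxis], ?_⟩
  -- In the plane `z = 0` the equation is `y^a = x^d`, parametrized by `(t^a, t^d)`.
  let φ : ℝ → EuclideanSpace ℝ (Fin 3) := fun t => !₂[t ^ a, t ^ d, 0]
  have hφ : Continuous φ := by
    refine (PiLp.continuous_toLp 2 _).comp (continuous_pi fun i => ?_)
    fin_cases i <;> simp <;> fun_prop
  have h0 : φ 0 = 0 := by
    ext i
    fin_cases i <;> simp [φ, ha.ne', hd.ne']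
  have h1 : Tendsto φ (𝓝[>] 0) (𝓝 0) := by
    rw [← h0]
    exact hφ.continuousAt.mono_left nhdsWithin_le_nhds
  refine mem_closure_of_tendsto h1 ?_
  filter_upwards [self_mem_nhdsWithin] with t ht
  have ht : 0 < t := ht
  refine (mem_stratum_iff ha hc hd).2 ⟨by simp [φ, ht.ne'], ?_⟩
  simp [φ, hb.ne', ← pow_mul, mul_comm]

theorem inner_normal_sub (p q : EuclideanSpace ℝ (Fin 3)) (hq : q ∈ zAxis) :
    ⟪normal a b c d p, q - p⟫_ℝ =
      gradX b c d p * p 0 - gradY a p * p 1 - gradZ b c p * (q 2 - p 2) := by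
  simp only [zAxis, mem_ofPred_eq] at hq
  simp [normal, PiLp.inner_apply, Fin.sum_univ_three, hq.1, hq.2]
  ring

theorem abs_le_norm_fin_three (v : EuclideanSpace ℝ (Fin 3)) (i : Fin 3) : |v i| ≤ ‖v‖ := by
  simpa using PiLp.norm_apply_le v i

theorem norm_le_sum_fin_three (v : EuclideanSpace ℝ (Fin 3)) : ‖v‖ ≤ |v 0| + |v 1| + |v 2| := by
  rw [EuclideanSpace.norm_eq, Fin.sum_univ_three]
  simp only [Real.norm_eq_abs]
  refine Real.sqrt_le_iff.2 ⟨by positivity, ?_⟩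
  nlinarith [abs_nonneg (v 0), abs_nonneg (v 1), abs_nonneg (v 2),
    mul_nonneg (abs_nonneg (v 0)) (abs_nonneg (v 1)),
    mul_nonneg (abs_nonneg (v 0)) (abs_nonneg (v 2)),
    mul_nonneg (abs_nonneg (v 1)) (abs_nonneg (v 2))]

/-- Regularity in coordinates: the `z`-component of the gradient is negligible (the limit tangent
planes contain `Oz`), and so is its component along `(x, y)`. -/
theorem isBRegularAt_stratum_iff (ha : 0 < a) (hb : 0 < b) (hc : 0 < c) (hd : 0 < d) :
    IsBRegularAt (surface a b c d \ zAxis) zAxis 0 ↔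
      (gradZ b c =o[𝓝[surface a b c d \ zAxis] 0] fun p => |gradX b c d p| + |gradY a p|) ∧
      ((fun p => gradX b c d p * p 0 - gradY a p * p 1) =o[𝓝[surface a b c d \ zAxis] 0]
        fun p => (|gradX b c d p| + |gradY a p|) * (|p 0| + |p 1|)) := by
  rw [isBRegularAt_iff_isLittleO
    (fun p hp => normal_ne_zero (a := a) (c := c) hb hd ((mem_stratum_iff ha hc hd).1 hp).1)
    (fun p hp => tangentSpaceAt_stratum ha hb hc hd hp) disjoint_sdiff_left]
  set X := surface a b c d \ zAxis with hX
  have hnorm : ∀ p, ‖normal a b c d p‖ ≤ |gradX b c d p| + |gradY a p| + |gradZ b c p| := by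
    intro p
    simpa [normal] using norm_le_sum_fin_three (normal a b c d p)
  constructor
  · intro h
    -- Testing with `q = (0, 0, z + η)` gives `q - p = (-x, -y, η)` with `η` free: `η = 0` yields
    -- the radial condition, and subtracting the case `η = |x| + |y|` isolates the `z`-component.
    have key : ∀ η : EuclideanSpace ℝ (Fin 3) → ℝ, Tendsto η (𝓝[X] 0) (𝓝 0) →
        (fun p => gradX b c d p * p 0 - gradY a p * p 1 - gradZ b c p * η p) =o[𝓝[X] 0]
          fun p => ‖normal a b c d p‖ * (|p 0| + |p 1| + |η p|) := by
      intro η hη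
      let q : EuclideanSpace ℝ (Fin 3) → EuclideanSpace ℝ (Fin 3) := fun p => !₂[0, 0, p 2 + η p]
      have hp2 : Tendsto (fun p : EuclideanSpace ℝ (Fin 3) => p 2) (𝓝[X] 0) (𝓝 0) := by
        have : Continuous fun p : EuclideanSpace ℝ (Fin 3) => p 2 := by fun_prop
        simpa using (this.tendsto 0).mono_left (nhdsWithin_le_nhds (s := X))
      have hq : Tendsto q (𝓝[X] 0) (𝓝 0) := by
        refine squeeze_zero_norm (fun p => norm_le_sum_fin_three _) ?_
        simpa [q] using (hp2.add hη).abs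
      have hpq : Tendsto (fun p => (p, q p)) (𝓝[X] 0) (𝓝[X ×ˢ zAxis] (0, 0)) := by
        refine tendsto_nhdsWithin_iff.2
          ⟨(tendsto_id.mono_left nhdsWithin_le_nhds).prodMk_nhds hq, ?_⟩
        filter_upwards [self_mem_nhdsWithin] with p hp
        exact ⟨hp, by simp [q, zAxis]⟩
      have h1 := h.comp_tendsto hpq
      refine (h1.congr_left fun p => ?_).trans_le fun p => ?_
      · simp only [Function.comp]
        rw [inner_normal_sub _ _ (by simp [q, zAxis])]
        simp [q]
      · simp only [Function.comp]
        rw [norm_mul, norm_mul, norm_norm, norm_norm]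
        refine mul_le_mul_of_nonneg_left ?_ (norm_nonneg _)
        rw [Real.norm_of_nonneg (by positivity)]
        refine (norm_le_sum_fin_three _).trans_eq ?_
        simp [q]
    have h0 := key (fun _ => 0) tendsto_const_nhds
    simp only [mul_zero, sub_zero, abs_zero, add_zero] at h0
    have h1 : (fun p => gradZ b c p * (|p 0| + |p 1|)) =o[𝓝[X] 0]
        fun p => ‖normal a b c d p‖ * (|p 0| + |p 1|) := by
      have hη : Tendsto (fun p : EuclideanSpace ℝ (Fin 3) => |p 0| + |p 1|) (𝓝[X] 0) (𝓝 0) := by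
        have : Continuous fun p : EuclideanSpace ℝ (Fin 3) => |p 0| + |p 1| := by fun_prop
        simpa using (this.tendsto 0).mono_left (nhdsWithin_le_nhds (s := X))
      refine ((h0.sub ((key _ hη).trans_isBigO (IsBigO.of_bound 2 ?_))).congr_left fun p => ?_)
      · refine .of_forall fun p => ?_
        have : |(|p 0| + |p 1|)| = |p 0| + |p 1| := abs_of_nonneg (by positivity)
        rw [this, Real.norm_of_nonneg (by positivity), Real.norm_of_nonneg (by positivity)]
        exact le_of_eq (by ring)
      · ring
    have hZ : gradZ b c =o[𝓝[X] 0] fun p => |gradX b c d p| + |gradY a p| := by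
      rw [isLittleO_iff] at h1 ⊢
      intro ε hε
      -- The constant `ε / (1 + ε)` lets `|gradZ|`, which also occurs in the bound for `‖normal‖`,
      -- be absorbed on the left, leaving exactly `ε`.
      filter_upwards [h1 (c := ε / (1 + ε)) (by positivity), self_mem_nhdsWithin] with p hp hpX
      have hp0 : 0 < |p 0| := abs_pos.2 ((mem_stratum_iff ha hc hd).1 hpX).1
      have hs : 0 < |p 0| + |p 1| := by positivity
      rw [norm_mul, norm_mul, norm_norm, ← mul_assoc] at hp
      have hp := le_of_mul_le_mul_right hp (norm_pos_iff.2 hs.ne')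
      rw [div_mul_eq_mul_div, le_div_iff₀ (by positivity)] at hp
      have := mul_le_mul_of_nonneg_left (hnorm p) hε.le
      rw [Real.norm_eq_abs] at hp ⊢
      rw [Real.norm_of_nonneg (by positivity)]
      linarith
    refine ⟨hZ, h0.trans_isBigO (IsBigO.mul ?_ (isBigO_refl _ _))⟩
    have h3 : (fun p => |gradX b c d p| + |gradY a p| + |gradZ b c p|) =O[𝓝[X] 0]
        fun p => |gradX b c d p| + |gradY a p| :=
      (isBigO_refl _ _).add hZ.isBigO.abs_left
    refine IsBigO.trans (IsBigO.of_bound 1 (.of_forall fun p => ?_)) h3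
    rw [norm_norm, one_mul]
    exact (hnorm p).trans (le_abs_self _)
  · rintro ⟨hZ, hXY⟩
    have hfst : Tendsto (Prod.fst : EuclideanSpace ℝ (Fin 3) × EuclideanSpace ℝ (Fin 3) → _)
        (𝓝[X ×ˢ zAxis] (0, 0)) (𝓝[X] 0) := by
      refine tendsto_nhdsWithin_iff.2
        ⟨(continuous_fst.tendsto _).mono_left nhdsWithin_le_nhds, ?_⟩
      filter_upwards [self_mem_nhdsWithin] with r hr using hr.1
    have hN : ∀ p, |gradX b c d p| + |gradY a p| ≤ 2 * ‖normal a b c d p‖ := by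
      intro p
      have h0 := abs_le_norm_fin_three (normal a b c d p) 0
      have h1 := abs_le_norm_fin_three (normal a b c d p) 1
      simp only [normal, PiLp.toLp_apply, Matrix.cons_val_zero, Matrix.cons_val_one,
        abs_neg] at h0 h1
      simp only [normal]
      linarith
    have hNO : (fun p => |gradX b c d p| + |gradY a p|) =O[𝓝[X] 0] fun p => ‖normal a b c d p‖ :=
      IsBigO.of_bound 2 (.of_forall fun p => by
        rw [norm_norm, Real.norm_of_nonneg (by positivity)]
        exact hN p)
    have hmem : ∀ᶠ r in 𝓝[X ×ˢ zAxis] ((0, 0) : EuclideanSpace ℝ (Fin 3) × _),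
        r.2 ∈ zAxis := by
      filter_upwards [self_mem_nhdsWithin] with r hr using hr.2
    have h1 := (hZ.trans_isBigO hNO).comp_tendsto hfst
    have h2 := hXY.comp_tendsto hfst
    have h3 : (fun r : EuclideanSpace ℝ (Fin 3) × EuclideanSpace ℝ (Fin 3) => r.2 2 - r.1 2)
        =O[𝓝[X ×ˢ zAxis] (0, 0)] fun r => ‖r.2 - r.1‖ :=
      IsBigO.of_bound 1 (.of_forall fun r => by
        rw [norm_norm, one_mul]
        exact abs_le_norm_fin_three (r.2 - r.1) 2)
    -- As `q` lies on `Oz`, both `|x|` and `|y|` are components of `q - p`.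
    have h4 : (fun r : EuclideanSpace ℝ (Fin 3) × EuclideanSpace ℝ (Fin 3) => |r.1 0| + |r.1 1|)
        =O[𝓝[X ×ˢ zAxis] (0, 0)] fun r => ‖r.2 - r.1‖ := by
      refine IsBigO.of_bound 2 ?_
      filter_upwards [hmem] with r hr
      have h0 := abs_le_norm_fin_three (r.2 - r.1) 0
      have h1 := abs_le_norm_fin_three (r.2 - r.1) 1
      simp only [zAxis, mem_ofPred_eq] at hr
      simp only [PiLp.sub_apply, hr.1, hr.2, zero_sub, abs_neg] at h0 h1
      rw [norm_norm, Real.norm_of_nonneg (by positivity)]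
      linarith
    have h5 := (h2.trans_isBigO ((hNO.comp_tendsto hfst).mul h4)).sub (h1.mul_isBigO h3)
    refine h5.congr' ?_ .rfl
    filter_upwards [hmem] with r hr
    rw [inner_normal_sub _ _ hr]
    rfl

end Surface

/-! ### Monomial inequalities, applied with `X = |x|`, `Z = |z|`, `m = d - c`, `S = z^b + x^(d-c)`
-/

section Inequalities

variable {X Z S : ℝ} {a b c m : ℕ}

/-- Use `Z^b ≤ S` to the power `b - 1` and `X^b = X^m X^(b-m) ≤ S X^(b-m)`. For `m < b` the factor
`X^(b-m)` is small. -/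
theorem pow_mul_pow_le_of_le_add (hX : 0 ≤ X) (hZ : 0 ≤ Z) (hZS : Z ^ b ≤ S) (hXS : X ^ m ≤ S)
    (hb : 0 < b) (hm : m ≤ b) : (Z ^ (b - 1) * X) ^ b ≤ X ^ (b - m) * S ^ b := by
  have hS : 0 ≤ S := (pow_nonneg hX m).trans hXS
  obtain ⟨b, rfl⟩ := Nat.exists_eq_succ_of_ne_zero hb.ne'
  obtain ⟨k, hk⟩ := Nat.exists_eq_add_of_le hm
  calc (Z ^ (b.succ - 1) * X) ^ b.succ = (Z ^ b.succ) ^ b * (X ^ m * X ^ k) := by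
        rw [← pow_add X, ← hk, mul_pow, ← pow_mul, ← pow_mul, Nat.succ_sub_one, mul_comm b]
    _ ≤ S ^ b * (S * X ^ k) := by gcongr
    _ = X ^ (b.succ - m) * S ^ b.succ := by
        rw [show b.succ - m = k by omega, pow_succ]
        ring

/-- Here `X^c S` stands for `|y|^a`. The identity `a (b - 1) = b (a - 1) + (b - a)` leaves the small
factor `X^c Z^(b-a)` after `Z^b ≤ S` is used `a - 1` times. -/
theorem pow_mul_pow_le_of_le (hX : 0 ≤ X) (hZ : 0 ≤ Z) (hZS : Z ^ b ≤ S)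
    (ha : 0 < a) (hab : a ≤ b) :
    (Z ^ (b - 1) * X ^ c) ^ a ≤ X ^ c * Z ^ (b - a) * (X ^ c * S) ^ (a - 1) := by
  obtain ⟨a, rfl⟩ := Nat.exists_eq_succ_of_ne_zero ha.ne'
  obtain ⟨k, rfl⟩ := Nat.exists_eq_add_of_le hab
  calc (Z ^ (a.succ + k - 1) * X ^ c) ^ a.succ
        = X ^ c * Z ^ k * ((X ^ c) ^ a * (Z ^ (a.succ + k)) ^ a) := by
        rw [show a.succ + k - 1 = a + k by omega, mul_pow, ← pow_mul, ← pow_mul, Nat.succ_eq_add_one]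
        ring
    _ ≤ X ^ c * Z ^ k * ((X ^ c) ^ a * S ^ a) := by gcongr
    _ = _ := by rw [← mul_pow, Nat.add_sub_cancel_left, Nat.succ_sub_one]

/-- Now `Z^b ≤ S` supplies only `a (b - 1)` of the `b (a - 1)` powers of `S`. The missing `a - b`
come from `X^m ≤ S`, paid for by the spare factor `X^(b c)`. -/
theorem pow_mul_pow_le_of_lt (hX : 0 ≤ X) (hZ : 0 ≤ Z) (hZS : Z ^ b ≤ S) (hXS : X ^ m ≤ S)
    (hb : 0 < b) (hab : b < a) (hm : (a - b) * m ≤ b * c) :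
    (Z ^ (b - 1) * X ^ c) ^ (a * b) ≤
      X ^ (b * c - (a - b) * m) * (X ^ c * S) ^ ((a - 1) * b) := by
  have hS : 0 ≤ S := (pow_nonneg hX m).trans hXS
  obtain ⟨b, rfl⟩ := Nat.exists_eq_succ_of_ne_zero hb.ne'
  obtain ⟨k, rfl⟩ := Nat.exists_eq_add_of_lt hab
  obtain ⟨e, he⟩ := Nat.exists_eq_add_of_le hm
  rw [show b.succ + k + 1 - b.succ = k + 1 by omega] at he
  have h1 : b.succ + k + 1 - 1 = b + 1 + k := by omega
  have h2 : b.succ * c - (b.succ + k + 1 - b.succ) * m = e := by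
    rw [show b.succ + k + 1 - b.succ = k + 1 by omega, he]; omega
  rw [h1, h2, Nat.succ_sub_one]
  calc (Z ^ b * X ^ c) ^ ((b.succ + k + 1) * b.succ)
        = (Z ^ b.succ) ^ (b * (b.succ + k + 1)) *
          (X ^ (b.succ * c) * (X ^ c) ^ ((b + 1 + k) * b.succ)) := by
        rw [mul_pow, ← pow_mul, ← pow_mul, ← pow_mul, ← pow_mul, ← pow_add, Nat.succ_eq_add_one]
        congr 2 <;> ring
    _ = (Z ^ b.succ) ^ (b * (b.succ + k + 1)) *
          ((X ^ m) ^ (k + 1) * X ^ e * (X ^ c) ^ ((b + 1 + k) * b.succ)) := by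
        rw [he, pow_add X, mul_comm (k + 1) m, pow_mul X m]
    _ ≤ S ^ (b * (b.succ + k + 1)) *
          (S ^ (k + 1) * X ^ e * (X ^ c) ^ ((b + 1 + k) * b.succ)) := by gcongr
    _ = X ^ e * ((X ^ c) ^ ((b + 1 + k) * b.succ) *
          (S ^ (b * (b.succ + k + 1)) * S ^ (k + 1))) := by ring
    _ = _ := by
        rw [← pow_add S, mul_pow]
        congr 3
        rw [Nat.succ_eq_add_one]
        ring

end Inequalities

/-! ### Asymptotic comparison of real functions -/

section Asymp

variable {α : Type*} {l : Filter α} {f g e : α → ℝ}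

theorem isLittleO_of_norm_le_mul (he : Tendsto e l (𝓝 0))
    (h : ∀ᶠ p in l, ‖f p‖ ≤ ‖e p‖ * ‖g p‖) : f =o[l] g := by
  have h1 : (fun p => e p * g p) =o[l] g := by
    simpa using ((isLittleO_one_iff ℝ).2 he).mul_isBigO (isBigO_refl g l)
  refine IsBigO.trans_isLittleO (IsBigO.of_bound 1 ?_) h1
  filter_upwards [h] with p hp
  rwa [one_mul, norm_mul]

/-- Comparing `n`-th powers avoids fractional exponents. -/
theorem isLittleO_of_pow_le {n : ℕ} (hn : n ≠ 0) (he : Tendsto e l (𝓝 0))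
    (h : ∀ᶠ p in l, |f p| ^ n ≤ |e p| * |g p| ^ n) : f =o[l] g := by
  refine IsLittleO.of_pow (n := n) (isLittleO_of_norm_le_mul he ?_) hn
  filter_upwards [h] with p hp
  simpa [norm_pow] using hp

theorem IsLittleO.of_mul_right (he : ∀ᶠ p in l, e p ≠ 0)
    (h : (fun p => f p * e p) =o[l] fun p => g p * e p) : f =o[l] g := by
  rw [isLittleO_iff] at h ⊢
  intro ε hε
  filter_upwards [h hε, he] with p hp hep
  rw [norm_mul, norm_mul, ← mul_assoc] at hp
  exact le_of_mul_le_mul_right hp (norm_pos_iff.2 hep)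

theorem isTheta_mul_of_tendsto {k : ℝ} (hk : k ≠ 0) (hf : Tendsto f l (𝓝 k)) :
    (fun p => g p * f p) =Θ[l] g := by
  have h1 : f =Θ[l] fun _ => (1 : ℝ) := by
    refine ⟨hf.isBigO_one ℝ, ?_⟩
    refine (isBigO_const_left_iff_pos_le_norm one_ne_zero).2 ⟨|k| / 2, by positivity, ?_⟩
    have : |k| / 2 < |k| := by have := abs_pos.2 hk; linarith
    filter_upwards [hf.abs.eventually (lt_mem_nhds this)] with p hp using hp.le
  simpa using (isTheta_refl g l).mul h1

end Asymp

/-! ### The regular cases -/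

section Regular

variable {a b c d : ℕ}

theorem tendsto_coord (X : Set (EuclideanSpace ℝ (Fin 3))) (i : Fin 3) :
    Tendsto (fun p : EuclideanSpace ℝ (Fin 3) => p i) (𝓝[X] 0) (𝓝 0) := by
  have : Continuous fun p : EuclideanSpace ℝ (Fin 3) => p i := by fun_prop
  simpa using (this.tendsto 0).mono_left (nhdsWithin_le_nhds (s := X))

theorem tendsto_coord_pow (X : Set (EuclideanSpace ℝ (Fin 3))) (i : Fin 3) {n : ℕ} (hn : n ≠ 0) :
    Tendsto (fun p : EuclideanSpace ℝ (Fin 3) => p i ^ n) (𝓝[X] 0) (𝓝 0) := by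
  simpa [hn] using (tendsto_coord X i).pow n

theorem eventually_mem_stratum (ha : 0 < a) (hc : 0 < c) (hd : 0 < d) :
    ∀ᶠ p in 𝓝[surface a b c d \ zAxis] 0, p 0 ≠ 0 ∧ p 1 ^ a = p 2 ^ b * p 0 ^ c + p 0 ^ d := by
  filter_upwards [self_mem_nhdsWithin] with p hp using (mem_stratum_iff ha hc hd).1 hp

/-- The factor `x` removes the truncated exponents and leaves the monomials of the defining
equation, so the two can be compared on `X`. -/
theorem gradX_mul (hc : 0 < c) (hd : 0 < d) (p : EuclideanSpace ℝ (Fin 3)) :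
    gradX b c d p * p 0 = c * (p 2 ^ b * p 0 ^ c) + d * p 0 ^ d := by
  obtain ⟨c, rfl⟩ := Nat.exists_eq_succ_of_ne_zero hc.ne'
  obtain ⟨d, rfl⟩ := Nat.exists_eq_succ_of_ne_zero hd.ne'
  simp only [gradX, Nat.succ_sub_one, pow_succ]
  ring

theorem gradY_mul (ha : 0 < a) (p : EuclideanSpace ℝ (Fin 3)) :
    gradY a p * p 1 = a * p 1 ^ a := by
  obtain ⟨a, rfl⟩ := Nat.exists_eq_succ_of_ne_zero ha.ne'
  simp only [gradY, Nat.succ_sub_one, pow_succ]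
  ring

theorem isBigO_abs_add_left {α : Type*} {l : Filter α} (f g : α → ℝ) :
    f =O[l] fun p => |f p| + |g p| :=
  IsBigO.of_bound 1 (.of_forall fun p => by
    rw [one_mul, Real.norm_eq_abs, Real.norm_of_nonneg (by positivity)]
    exact le_add_of_nonneg_right (abs_nonneg _))

theorem isBigO_abs_add_right {α : Type*} {l : Filter α} (f g : α → ℝ) :
    g =O[l] fun p => |f p| + |g p| :=
  IsBigO.of_bound 1 (.of_forall fun p => by
    rw [one_mul, Real.norm_eq_abs, Real.norm_of_nonneg (by positivity)]
    exact le_add_of_nonneg_left (abs_nonneg _))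

/-- The component of the unit normal along `(x, y)` is negligible as soon as `x` and `y` have
different orders and `x ∂f/∂x` and `y ∂f/∂y` have the same order. -/
theorem isLittleO_radial_of_isTheta (ha : 0 < a) {l : Filter (EuclideanSpace ℝ (Fin 3))}
    (hΘ : (fun p => gradX b c d p * p 0) =Θ[l] fun p => p 1 ^ a)
    (h : ((fun p => p 1) =o[l] fun p => p 0) ∨ ((fun p => p 0) =o[l] fun p => p 1)) :
    (fun p => gradX b c d p * p 0 - gradY a p * p 1) =o[l]
      fun p => (|gradX b c d p| + |gradY a p|) * (|p 0| + |p 1|) := by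
  have ha' : (a : ℝ) ≠ 0 := by positivity
  have hY : (fun p => gradY a p * p 1) =Θ[l] fun p => p 1 ^ a := by
    simp only [gradY_mul ha]
    exact (isTheta_const_mul_left ha').2 (isTheta_refl _ _)
  rcases h with h | h
  · have h1 : (fun p => gradY a p * p 1) =o[l]
        fun p => (|gradX b c d p| + |gradY a p|) * (|p 0| + |p 1|) :=
      ((isBigO_refl _ _).mul_isLittleO h).trans_isBigO
        ((isBigO_abs_add_right _ _).mul (isBigO_abs_add_left _ _))
    exact (((hΘ.trans hY.symm).isBigO).trans_isLittleO h1).sub h1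
  · have h1 : (fun p => gradX b c d p * p 0) =o[l]
        fun p => (|gradX b c d p| + |gradY a p|) * (|p 0| + |p 1|) :=
      ((isBigO_refl _ _).mul_isLittleO h).trans_isBigO
        ((isBigO_abs_add_left _ _).mul (isBigO_abs_add_right _ _))
    exact h1.sub (((hY.trans hΘ.symm).isBigO).trans_isLittleO h1)

/-- The `y`-derivative is `1`, so it suffices that `gradZ → 0` and that the radial term `(c - 1) z^b
x^c + (d - 1) x^d` is `o(x)`. -/
theorem isBRegularAt_of_eq_one (hb : 0 < b) (hc : 0 < c) (hd : 0 < d) :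
    IsBRegularAt (surface 1 b c d \ zAxis) zAxis 0 := by
  rw [isBRegularAt_stratum_iff one_pos hb hc hd]
  set X := surface 1 b c d \ zAxis
  have hone : (fun _ => (1 : ℝ)) =O[𝓝[X] 0] fun p => |gradX b c d p| + |gradY 1 p| := by
    exact (isBigO_abs_add_right (l := 𝓝[X] 0) (gradX b c d) (gradY 1)).congr_left
      fun p => by simp [gradY]
  have hxc := tendsto_coord_pow X 0 hc.ne'
  have hzb := tendsto_coord_pow X 2 hb.ne'
  constructor
  · refine IsLittleO.trans_isBigO ((isLittleO_one_iff ℝ).2 ?_) hone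
    change Tendsto (fun p : EuclideanSpace ℝ (Fin 3) => (b : ℝ) * p 2 ^ (b - 1) * p 0 ^ c) _ _
    simpa using (((tendsto_coord X 2).pow (b - 1)).const_mul (b : ℝ)).mul hxc
  · have h1 : (fun p : EuclideanSpace ℝ (Fin 3) => p 2 ^ b * p 0 ^ c) =o[𝓝[X] 0] fun p => p 0 := by
      have := ((isLittleO_one_iff ℝ).2 hzb).mul_isBigO
        (((isBigO_refl (fun p : EuclideanSpace ℝ (Fin 3) => p 0) (𝓝[X] 0)).mul
          (((tendsto_coord X 0).pow (c - 1)).isBigO_one ℝ)))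
      refine (this.congr (fun p => ?_) fun p => by simp)
      rw [← pow_succ', Nat.sub_add_cancel hc]
    have h2 : (fun p : EuclideanSpace ℝ (Fin 3) => ((d : ℝ) - 1) * p 0 ^ d) =o[𝓝[X] 0]
        fun p => p 0 := by
      rcases Nat.lt_or_ge 1 d with h | h
      · have h1 := tendsto_coord_pow X 0 (show d - 1 ≠ 0 by omega)
        refine IsLittleO.const_mul_left ?_ _
        have := (isBigO_refl (fun p : EuclideanSpace ℝ (Fin 3) => p 0) (𝓝[X] 0)).mul_isLittleO
          ((isLittleO_one_iff ℝ).2 h1)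
        refine this.congr (fun p => ?_) fun p => by simp
        rw [← pow_succ', Nat.sub_add_cancel hd]
      -- For `d = 1` the power is not small, but its coefficient `d - 1` vanishes.
      · obtain rfl : d = 1 := by omega
        simp
    have h3 := (h1.const_mul_left ((c : ℝ) - 1)).add h2
    have h4 : (fun p : EuclideanSpace ℝ (Fin 3) => p 0) =O[𝓝[X] 0]
        fun p => (|gradX b c d p| + |gradY 1 p|) * (|p 0| + |p 1|) := by
      simpa using hone.mul (isBigO_abs_add_left (l := 𝓝[X] 0)
        (fun p : EuclideanSpace ℝ (Fin 3) => p 0) fun p => p 1)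
    refine (h3.trans_isBigO h4).congr' ?_ .rfl
    filter_upwards [eventually_mem_stratum (b := b) one_pos hc hd] with p hp
    rw [gradX_mul hc hd, gradY_mul one_pos, hp.2]
    push_cast
    ring

/-- Factoring `z^b x^c = x^d (z^b x^(c-d))` with second factor tending to `0`, both `x gradX` and
`y^a` have the order of `x^d`. -/
theorem isBRegularAt_of_le (ha : 1 < a) (hb : 0 < b) (hd : 0 < d) (hdc : d ≤ c) :
    IsBRegularAt (surface a b c d \ zAxis) zAxis 0 := by
  have ha0 : 0 < a := by omega
  have hc : 0 < c := by omega
  rw [isBRegularAt_stratum_iff ha0 hb hc hd]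
  set X := surface a b c d \ zAxis
  have hmem := eventually_mem_stratum (b := b) ha0 hc hd
  have hu : Tendsto (fun p : EuclideanSpace ℝ (Fin 3) => p 2 ^ b * p 0 ^ (c - d)) (𝓝[X] 0)
      (𝓝 0) := by
    simpa using (tendsto_coord_pow X 2 hb.ne').mul ((tendsto_coord X 0).pow (c - d))
  have hcd : ∀ p : EuclideanSpace ℝ (Fin 3), p 0 ^ c = p 0 ^ d * p 0 ^ (c - d) := fun p => by
    rw [← pow_add, Nat.add_sub_of_le hdc]
  have hΘX : (fun p => gradX b c d p * p 0) =Θ[𝓝[X] 0] fun p => p 0 ^ d := by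
    have hd' : (d : ℝ) ≠ 0 := by positivity
    have h1 := (hu.const_mul (c : ℝ)).add_const (d : ℝ)
    rw [mul_zero, zero_add] at h1
    refine IsTheta.trans (EventuallyEq.isTheta (.of_forall fun p => ?_))
      (isTheta_mul_of_tendsto (g := fun p => p 0 ^ d) hd' h1)
    simp only [gradX_mul hc hd, hcd]
    ring
  have hΘY : (fun p : EuclideanSpace ℝ (Fin 3) => p 1 ^ a) =Θ[𝓝[X] 0] fun p => p 0 ^ d := by
    have h1 := hu.add_const (1 : ℝ)
    rw [zero_add] at h1
    refine IsTheta.trans (EventuallyEq.isTheta ?_)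
      (isTheta_mul_of_tendsto (g := fun p => p 0 ^ d) one_ne_zero h1)
    filter_upwards [hmem] with p hp
    rw [hp.2, hcd]
    ring
  have hpow : ∀ {m n : ℕ}, m < n → (fun p : EuclideanSpace ℝ (Fin 3) => p 0 ^ n) =o[𝓝[X] 0]
      fun p => p 0 ^ m := fun hmn => (isLittleO_pow_pow hmn).comp_tendsto (tendsto_coord X 0)
  constructor
  · refine IsLittleO.trans_isBigO ?_ (isBigO_abs_add_left _ _)
    refine IsLittleO.of_mul_right (hmem.mono fun p hp => hp.1) (IsLittleO.trans_isBigO ?_ hΘX.2)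
    refine (((((tendsto_coord X 2).pow (b - 1)).const_mul (b : ℝ)).isBigO_one ℝ).mul_isLittleO
      (hpow (show d < c + 1 by omega))).congr (fun p => ?_) fun p => by simp
    simp only [gradZ]
    ring
  · rcases lt_trichotomy d a with h | h | h
    · refine isLittleO_radial_of_isTheta ha0 (hΘX.trans hΘY.symm) (.inr ?_)
      exact IsLittleO.of_pow (n := a) ((hpow h).trans_isBigO hΘY.2) ha0.ne'
    -- For `d = a`, `x` and `y` have the same order, but the `x^d` terms cancel and leave `(c - a)
    -- z^b x^c`.
    · have h1 : (fun p => gradX b c d p * p 0) =O[𝓝[X] 0]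
          fun p => (|gradX b c d p| + |gradY a p|) * (|p 0| + |p 1|) :=
        (isBigO_abs_add_left _ _).mul (isBigO_abs_add_left _ _)
      have h2 : (fun p : EuclideanSpace ℝ (Fin 3) => ((c : ℝ) - a) * (p 2 ^ b * p 0 ^ c))
          =o[𝓝[X] 0] fun p => p 0 ^ d := by
        refine IsLittleO.const_mul_left ?_ _
        refine (((isLittleO_one_iff ℝ).2 hu).mul_isBigO (isBigO_refl
          (fun p : EuclideanSpace ℝ (Fin 3) => p 0 ^ d) (𝓝[X] 0))).congr (fun p => ?_)
          fun p => by simp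
        rw [hcd]
        ring
      refine ((h2.trans_isBigO hΘX.2).trans_isBigO h1).congr' ?_ .rfl
      filter_upwards [hmem] with p hp
      rw [gradX_mul hc hd, gradY_mul ha0, hp.2, h]
      ring
    · refine isLittleO_radial_of_isTheta ha0 (hΘX.trans hΘY.symm) (.inl ?_)
      exact IsLittleO.of_pow (n := a) (hΘY.1.trans_isLittleO (hpow h)) ha0.ne'

/-- In the even case there is no cancellation in `z^b + x^(d-c)`. -/
theorem isTheta_gradX_mul_of_even (ha : 0 < a) (hc : 0 < c) (hcd : c < d) (hb : Even b)
    (hdc : Even (d - c)) :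
    (fun p => gradX b c d p * p 0) =Θ[𝓝[surface a b c d \ zAxis] 0] fun p => p 1 ^ a := by
  have hd : 0 < d := by omega
  have hmem := eventually_mem_stratum (b := b) ha hc hd
  have hs : ∀ p : EuclideanSpace ℝ (Fin 3), p 0 ^ d = p 0 ^ c * p 0 ^ (d - c) := fun p => by
    rw [← pow_add, Nat.add_sub_of_le hcd.le]
  have hc1 : (1 : ℝ) ≤ c := by exact_mod_cast hc
  have hd1 : (1 : ℝ) ≤ d := by exact_mod_cast hd
  constructor
  · refine IsBigO.of_bound (c + d : ℝ) ?_
    filter_upwards [hmem] with p hp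
    have hz := hb.pow_nonneg (p 2)
    have hx := hdc.pow_nonneg (p 0)
    rw [gradX_mul hc hd, hp.2, hs,
      show (c : ℝ) * (p 2 ^ b * p 0 ^ c) + d * (p 0 ^ c * p 0 ^ (d - c)) =
        p 0 ^ c * (c * p 2 ^ b + d * p 0 ^ (d - c)) by ring,
      show p 2 ^ b * p 0 ^ c + p 0 ^ c * p 0 ^ (d - c) =
        p 0 ^ c * (p 2 ^ b + p 0 ^ (d - c)) by ring, norm_mul, norm_mul, ← mul_assoc,
      mul_comm (c + d : ℝ), mul_assoc]
    refine mul_le_mul_of_nonneg_left ?_ (norm_nonneg _)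
    rw [Real.norm_of_nonneg (by positivity), Real.norm_of_nonneg (by positivity)]
    nlinarith
  · refine IsBigO.of_bound 1 ?_
    filter_upwards [hmem] with p hp
    have hz := hb.pow_nonneg (p 2)
    have hx := hdc.pow_nonneg (p 0)
    rw [gradX_mul hc hd, hp.2, hs,
      show (c : ℝ) * (p 2 ^ b * p 0 ^ c) + d * (p 0 ^ c * p 0 ^ (d - c)) =
        p 0 ^ c * (c * p 2 ^ b + d * p 0 ^ (d - c)) by ring,
      show p 2 ^ b * p 0 ^ c + p 0 ^ c * p 0 ^ (d - c) =
        p 0 ^ c * (p 2 ^ b + p 0 ^ (d - c)) by ring, norm_mul, norm_mul, one_mul]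
    refine mul_le_mul_of_nonneg_left ?_ (norm_nonneg _)
    rw [Real.norm_of_nonneg (by positivity), Real.norm_of_nonneg (by positivity)]
    nlinarith

/-- The orders of `x` and `y` differ: if `d < a`, then `|x|^d ≤ |y|^a` gives `x = o(y)`; if `a ≤ c <
d`, both terms of `y^a` are `o(x^a)`, so `y = o(x)`. -/
theorem isLittleO_radial_of_even (ha : 0 < a) (hb0 : 0 < b) (hc : 0 < c) (hcd : c < d)
    (hb : Even b) (hdc : Even (d - c)) (h : d < a ∨ a ≤ c) :
    (fun p => gradX b c d p * p 0 - gradY a p * p 1) =o[𝓝[surface a b c d \ zAxis] 0]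
      fun p => (|gradX b c d p| + |gradY a p|) * (|p 0| + |p 1|) := by
  have hd : 0 < d := by omega
  have hmem := eventually_mem_stratum (b := b) ha hc hd
  refine isLittleO_radial_of_isTheta ha (isTheta_gradX_mul_of_even ha hc hcd hb hdc) ?_
  set X := surface a b c d \ zAxis
  have hpow : ∀ {m n : ℕ}, m < n → (fun p : EuclideanSpace ℝ (Fin 3) => p 0 ^ n) =o[𝓝[X] 0]
      fun p => p 0 ^ m := fun hmn => (isLittleO_pow_pow hmn).comp_tendsto (tendsto_coord X 0)
  rcases h with h | h
  · refine .inr (IsLittleO.of_pow (n := a) ((hpow h).trans_isBigO (IsBigO.of_bound 1 ?_)) ha.ne')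
    filter_upwards [hmem] with p hp
    have hz := hb.pow_nonneg (p 2)
    have hx := hdc.pow_nonneg (p 0)
    rw [Pi.pow_apply, hp.2, show p 0 ^ d = p 0 ^ c * p 0 ^ (d - c) by
      rw [← pow_add, Nat.add_sub_of_le hcd.le],
      show p 2 ^ b * p 0 ^ c + p 0 ^ c * p 0 ^ (d - c) =
        p 0 ^ c * (p 2 ^ b + p 0 ^ (d - c)) by ring, norm_mul, norm_mul, one_mul]
    refine mul_le_mul_of_nonneg_left ?_ (norm_nonneg _)
    rw [Real.norm_of_nonneg (by positivity), Real.norm_of_nonneg (by positivity)]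
    linarith
  · refine .inl (IsLittleO.of_pow (n := a) ?_ ha.ne')
    have h1 : (fun p : EuclideanSpace ℝ (Fin 3) => p 2 ^ b * p 0 ^ c) =o[𝓝[X] 0]
        fun p => p 0 ^ a := by
      have hO : (fun p : EuclideanSpace ℝ (Fin 3) => p 0 ^ c) =O[𝓝[X] 0] fun p => p 0 ^ a := by
        rcases h.eq_or_lt with h | h
        · rw [h]
        · exact (hpow h).isBigO
      simpa using ((isLittleO_one_iff ℝ).2 (tendsto_coord_pow X 2 hb0.ne')).mul_isBigO hO
    refine (h1.add (hpow (show a < d by omega))).congr' ?_ .rfl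
    filter_upwards [hmem] with p hp
    rw [Pi.pow_apply, hp.2]

/-- Comparison with `gradX`: after multiplying by `x` and factoring out `x^c`, it remains to see
`z^(b-1) x = o(z^b + x^(d-c))`. -/
theorem isLittleO_gradZ_of_lt_add (ha : 0 < a) (hc : 0 < c) (hcd : c < d)
    (hb0 : 0 < b) (hb : Even b) (hdc : Even (d - c)) (hdb : d < b + c) :
    gradZ b c =o[𝓝[surface a b c d \ zAxis] 0] fun p => |gradX b c d p| + |gradY a p| := by
  have hd : 0 < d := by omega
  have hmem := eventually_mem_stratum (b := b) ha hc hd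
  have hΘ := isTheta_gradX_mul_of_even ha hc hcd hb hdc
  set X := surface a b c d \ zAxis
  refine IsLittleO.trans_isBigO ?_ (isBigO_abs_add_left _ _)
  refine IsLittleO.of_mul_right (hmem.mono fun p hp => hp.1) (IsLittleO.trans_isBigO ?_ hΘ.2)
  have h1 : (fun p : EuclideanSpace ℝ (Fin 3) => p 2 ^ (b - 1) * p 0) =o[𝓝[X] 0]
      fun p => p 2 ^ b + p 0 ^ (d - c) := by
    refine isLittleO_of_pow_le hb0.ne' (tendsto_coord_pow X 0 (show b - (d - c) ≠ 0 by omega))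
      (.of_forall fun p => ?_)
    have hz := hb.pow_nonneg (p 2)
    have hx := hdc.pow_nonneg (p 0)
    rw [abs_mul, abs_pow, abs_pow, abs_of_nonneg (add_nonneg hz hx)]
    refine pow_mul_pow_le_of_le_add (abs_nonneg _) (abs_nonneg _) ?_ ?_ hb0 (by omega)
    · rw [hb.pow_abs]; linarith
    · rw [hdc.pow_abs]; linarith
  refine ((h1.const_mul_left (b : ℝ)).mul_isBigO (isBigO_refl
    (fun p : EuclideanSpace ℝ (Fin 3) => p 0 ^ c) (𝓝[X] 0))).congr' (.of_forall fun p => ?_) ?_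
  · simp only [gradZ]; ring
  · filter_upwards [hmem] with p hp
    rw [hp.2, show p 0 ^ d = p 0 ^ c * p 0 ^ (d - c) by
      rw [← pow_add, Nat.add_sub_of_le hcd.le]]
    ring

/-- Comparison with `gradY`, that is, of `z^(b-1) x^c` with `y^(a-1)`, through `|y|^a = |x|^c (z^b +
x^(d-c))`. -/
theorem isLittleO_gradZ_of_mul_lt (ha : 0 < a) (hc : 0 < c) (hcd : c < d)
    (hb0 : 0 < b) (hb : Even b) (hdc : Even (d - c))
    (h : a ≤ b ∨ b < a ∧ (a - b) * (d - c) < b * c) :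
    gradZ b c =o[𝓝[surface a b c d \ zAxis] 0] fun p => |gradX b c d p| + |gradY a p| := by
  have hd : 0 < d := by omega
  have hmem := eventually_mem_stratum (b := b) ha hc hd
  set X := surface a b c d \ zAxis
  refine IsLittleO.trans_isBigO ?_ (isBigO_abs_add_right _ _)
  have ha' : (a : ℝ) ≠ 0 := by positivity
  refine IsLittleO.const_mul_right ha' (g := fun p : EuclideanSpace ℝ (Fin 3) => p 1 ^ (a - 1)) ?_
  have hY : ∀ p : EuclideanSpace ℝ (Fin 3), p 1 ^ a = p 2 ^ b * p 0 ^ c + p 0 ^ d →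
      |p 1| ^ a = |p 0| ^ c * (p 2 ^ b + p 0 ^ (d - c)) := by
    intro p hp
    have hz := hb.pow_nonneg (p 2)
    have hx := hdc.pow_nonneg (p 0)
    rw [← abs_pow, hp, ← abs_of_nonneg (add_nonneg hz hx), ← abs_pow, ← abs_mul, mul_add,
      ← pow_add, Nat.add_sub_of_le hcd.le, mul_comm]
  suffices h1 : (fun p : EuclideanSpace ℝ (Fin 3) => p 2 ^ (b - 1) * p 0 ^ c) =o[𝓝[X] 0]
      fun p => p 1 ^ (a - 1) from
    (h1.const_mul_left (b : ℝ)).congr_left fun p => by simp only [gradZ]; ring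
  rcases h with h | ⟨h, hlt⟩
  · have he : Tendsto (fun p : EuclideanSpace ℝ (Fin 3) => p 0 ^ c * p 2 ^ (b - a)) (𝓝[X] 0)
        (𝓝 0) := by
      simpa using (tendsto_coord_pow X 0 hc.ne').mul ((tendsto_coord X 2).pow (b - a))
    refine isLittleO_of_pow_le ha.ne' he ?_
    filter_upwards [hmem] with p hp
    have hx := hdc.pow_nonneg (p 0)
    simp only [abs_mul, abs_pow]
    rw [← pow_mul |p 1|, mul_comm (a - 1), pow_mul, hY p hp.2]
    refine pow_mul_pow_le_of_le (abs_nonneg _) (abs_nonneg _) ?_ ha h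
    rw [hb.pow_abs]; linarith
  · refine isLittleO_of_pow_le (mul_pos ha hb0).ne' (tendsto_coord_pow X 0
      (show b * c - (a - b) * (d - c) ≠ 0 by omega)) ?_
    filter_upwards [hmem] with p hp
    have hz := hb.pow_nonneg (p 2)
    have hx := hdc.pow_nonneg (p 0)
    simp only [abs_mul, abs_pow]
    rw [← pow_mul |p 1|, show (a - 1) * (a * b) = a * ((a - 1) * b) by ring, pow_mul |p 1|,
      hY p hp.2]
    refine pow_mul_pow_le_of_lt (abs_nonneg _) (abs_nonneg _) ?_ ?_ hb0 h hlt.le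
    · rw [hb.pow_abs]; linarith
    · rw [hdc.pow_abs]; linarith

end Regular

/-! ### The non-regular cases, by explicit curves -/

section NotRegular

variable {a b c d : ℕ}

theorem tendsto_curve (ha : 0 < a) (hc : 0 < c) (hd : 0 < d) {x y z : ℝ → ℝ}
    (hx : Tendsto x (𝓝[>] 0) (𝓝 0)) (hy : Tendsto y (𝓝[>] 0) (𝓝 0))
    (hz : Tendsto z (𝓝[>] 0) (𝓝 0)) (hx0 : ∀ t, 0 < t → x t ≠ 0)
    (h : ∀ t, 0 < t → y t ^ a = z t ^ b * x t ^ c + x t ^ d) :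
    Tendsto (fun t => (!₂[x t, y t, z t] : EuclideanSpace ℝ (Fin 3))) (𝓝[>] 0)
      (𝓝[surface a b c d \ zAxis] 0) := by
  refine tendsto_nhdsWithin_iff.2 ⟨?_, ?_⟩
  · refine squeeze_zero_norm (fun t => norm_le_sum_fin_three _) ?_
    simpa using (hx.abs.add hy.abs).add hz.abs
  · filter_upwards [self_mem_nhdsWithin] with t ht
    exact (mem_stratum_iff ha hc hd).2 ⟨hx0 t ht, h t ht⟩

theorem tendsto_pow_nhdsGT {n : ℕ} (hn : n ≠ 0) :
    Tendsto (fun t : ℝ => t ^ n) (𝓝[>] 0) (𝓝 0) := by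
  have : Continuous fun t : ℝ => t ^ n := by fun_prop
  have h := this.tendsto 0
  rw [zero_pow hn] at h
  exact h.mono_left nhdsWithin_le_nhds

/-- If the surface meets `{y = 0}` along a curve through the origin off `Oz`, it is not
regular. -/
theorem not_isBRegularAt_of_tendsto (ha : 1 < a) (hb : 0 < b) (hc : 0 < c) (hcd : c < d)
    {ι : Type*} {l : Filter ι} [l.NeBot] {φ : ι → EuclideanSpace ℝ (Fin 3)}
    (hφ : Tendsto φ l (𝓝[surface a b c d \ zAxis] 0)) (hy : ∀ᶠ t in l, φ t 1 = 0) :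
    ¬ IsBRegularAt (surface a b c d \ zAxis) zAxis 0 := by
  have ha0 : 0 < a := by omega
  have hd : 0 < d := by omega
  rw [isBRegularAt_stratum_iff ha0 hb hc hd]
  rintro ⟨-, h⟩
  -- On `y = 0` the `y`-derivative vanishes as `a > 1`, so the radial condition says that `x gradX`
  -- is negligible against itself; yet there `z^b x^c = -x^d` makes it `(d - c) x^d ≠ 0`.
  have h1 : (fun t => gradX b c d (φ t) * φ t 0) =o[l] fun t => gradX b c d (φ t) * φ t 0 := by
    refine IsLittleO.of_norm_right ((h.comp_tendsto hφ).congr' ?_ ?_)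
    · filter_upwards [hy] with t ht
      simp [ht]
    · filter_upwards [hy] with t ht
      simp [ht, gradY, zero_pow (show a - 1 ≠ 0 by omega)]
  refine isLittleO_irrefl (Eventually.frequently ?_) h1
  filter_upwards [hy, hφ.eventually (eventually_mem_stratum ha0 hc hd)] with t ht hp
  have h2 := hp.2
  rw [ht, zero_pow ha0.ne'] at h2
  have h3 : (c : ℝ) * (φ t 2 ^ b * φ t 0 ^ c) + d * φ t 0 ^ d = ((d : ℝ) - c) * φ t 0 ^ d := by
    linear_combination (-(c : ℝ)) * h2
  rw [gradX_mul hc hd, h3]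
  have : (c : ℝ) < d := by exact_mod_cast hcd
  exact mul_ne_zero (by linarith) (pow_ne_zero _ hp.1)

/-- Oddness of `b` or `d - c` makes `z^b = -x^(d-c)` solvable: `(x, z)` is `(t^b, -t^(d-c))` or
`(-t^b, t^(d-c))`. -/
theorem not_isBRegularAt_of_odd (ha : 1 < a) (hb : 0 < b) (hc : 0 < c) (hcd : c < d)
    (h : Odd b ∨ Odd (d - c)) :
    ¬ IsBRegularAt (surface a b c d \ zAxis) zAxis 0 := by
  have ha0 : 0 < a := by omega
  have hd : 0 < d := by omega
  have hs : ∀ s : ℝ, s ^ d = s ^ c * s ^ (d - c) := fun s => by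
    rw [← pow_add, Nat.add_sub_of_le hcd.le]
  have h1 := tendsto_pow_nhdsGT hb.ne'
  have h2 := tendsto_pow_nhdsGT (show d - c ≠ 0 by omega)
  rcases h with h | h
  · refine not_isBRegularAt_of_tendsto ha hb hc hcd
      (tendsto_curve ha0 hc hd h1 (tendsto_const_nhds (x := (0 : ℝ))) (by simpa using h2.neg)
        (fun t ht => (pow_pos ht b).ne') fun t ht => ?_) (.of_forall fun t => rfl)
    rw [zero_pow ha0.ne', h.neg_pow, hs]
    ring
  · refine not_isBRegularAt_of_tendsto ha hb hc hcd
      (tendsto_curve ha0 hc hd (x := fun t => -t ^ b) (by simpa using h1.neg)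
        (tendsto_const_nhds (x := (0 : ℝ))) h2
        (fun t ht => (neg_neg_of_pos (pow_pos ht b)).ne) fun t ht => ?_) (.of_forall fun t => rfl)
    rw [zero_pow ha0.ne', hs, h.neg_pow]
    ring

theorem exists_pow_eq (ha : 0 < a) (r : ℝ → ℝ) (hr : ∀ t, 0 < t → 0 < r t)
    (hr0 : Tendsto r (𝓝[>] 0) (𝓝 0)) :
    ∃ y : ℝ → ℝ, Tendsto y (𝓝[>] 0) (𝓝 0) ∧ ∀ t, 0 < t → 0 < y t ∧ y t ^ a = r t := by
  have ha' : (0 : ℝ) < (a : ℝ)⁻¹ := by positivity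
  refine ⟨fun t => r t ^ (a : ℝ)⁻¹, ?_, fun t ht =>
    ⟨Real.rpow_pos_of_pos (hr t ht) _, Real.rpow_inv_natCast_pow (hr t ht).le ha.ne'⟩⟩
  have h := (Real.continuousAt_rpow_const 0 (a : ℝ)⁻¹ (.inr ha'.le)).tendsto
  rw [Real.zero_rpow ha'.ne'] at h
  exact h.comp hr0

/-- With `x = t^b` and `z = t^(a-c)` one gets `z^b x^c = x^a`, so `y^a = x^a + x^d` and `y` is
comparable to `x`. The radial term `(c - a) x^a + (d - a) x^d` is then of full order `x^a`, since `c
≠ a`. -/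
theorem not_isBRegularAt_of_lt_of_le (hb : 0 < b) (hc : 0 < c) (hca : c < a) (had : a ≤ d) :
    ¬ IsBRegularAt (surface a b c d \ zAxis) zAxis 0 := by
  have ha0 : 0 < a := by omega
  have hd : 0 < d := by omega
  rw [isBRegularAt_stratum_iff ha0 hb hc hd]
  rintro ⟨-, h⟩
  have hab : a * b ≠ 0 := (mul_pos ha0 hb).ne'
  have hdb : d * b ≠ 0 := (mul_pos hd hb).ne'
  obtain ⟨y, hy0, hy⟩ := exists_pow_eq ha0 (fun t => t ^ (a * b) + t ^ (d * b))
    (fun t ht => by positivity)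
    (by simpa using (tendsto_pow_nhdsGT hab).add (tendsto_pow_nhdsGT hdb))
  have hz : ∀ t : ℝ, (t ^ (a - c)) ^ b * (t ^ b) ^ c = t ^ (a * b) := fun t => by
    rw [← pow_mul, ← pow_mul, ← pow_add, mul_comm b c, ← add_mul, Nat.sub_add_cancel hca.le]
  have hx : ∀ t : ℝ, (t ^ b) ^ d = t ^ (d * b) := fun t => by rw [← pow_mul, mul_comm]
  have hφ := tendsto_curve (b := b) ha0 hc hd (tendsto_pow_nhdsGT hb.ne') hy0
    (tendsto_pow_nhdsGT (show a - c ≠ 0 by omega)) (fun t ht => (pow_pos ht b).ne')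
    (fun t ht => by rw [(hy t ht).2, hz, hx])
  have h1 : (fun t : ℝ => ((c : ℝ) - a) * t ^ (a * b) + ((d : ℝ) - a) * t ^ (d * b)) =o[𝓝[>] 0]
      fun t : ℝ => t ^ (a * b) := by
    -- The constant collects `x + y ≤ 3 x`, `x gradX ≤ (c + d) x^a` and `x gradY ≤ 2 a x^a`.
    refine ((h.comp_tendsto hφ).trans_isBigO
      (IsBigO.of_bound (3 * (c + d + 2 * a : ℝ)) ?_)).congr' ?_ .rfl
    · have hlt : ∀ᶠ t : ℝ in 𝓝[>] 0, t < 1 :=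
        (eventually_lt_nhds one_pos).filter_mono nhdsWithin_le_nhds
      filter_upwards [self_mem_nhdsWithin, hlt] with t ht ht1
      have ht : 0 < t := ht
      obtain ⟨hyp, hya⟩ := hy t ht
      set p : EuclideanSpace ℝ (Fin 3) := !₂[t ^ b, y t, t ^ (a - c)] with hp
      have hp0 : p 0 = t ^ b := rfl
      have hp1 : p 1 = y t := rfl
      have hp2 : p 2 = t ^ (a - c) := rfl
      have hle : t ^ (d * b) ≤ t ^ (a * b) :=
        pow_le_pow_of_le_one ht.le ht1.le (Nat.mul_le_mul_right b had)
      have htb : 0 < t ^ b := pow_pos ht b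
      have hta : 0 < t ^ (a * b) := pow_pos ht _
      have htd : 0 < t ^ (d * b) := pow_pos ht _
      have hxy : t ^ b ≤ y t := by
        refine le_of_pow_le_pow_left₀ ha0.ne' hyp.le ?_
        rw [hya, ← pow_mul, mul_comm b]
        linarith
      have hyx : y t ≤ 2 * t ^ b := by
        refine le_of_pow_le_pow_left₀ ha0.ne' (by positivity) ?_
        rw [hya, mul_pow, ← pow_mul, mul_comm b]
        have h2 : (2 : ℝ) ≤ 2 ^ a := le_self_pow₀ (by norm_num) ha0.ne'
        nlinarith
      have hX0 : 0 ≤ gradX b c d p := by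
        simp only [gradX, hp0, hp2]; positivity
      have hY0 : 0 ≤ gradY a p := by
        simp only [gradY, hp1]; positivity
      have hX : gradX b c d p * t ^ b ≤ (c + d) * t ^ (a * b) := by
        have := gradX_mul (b := b) hc hd p
        rw [hp0, hp2, hz, hx] at this
        rw [this, add_mul]
        gcongr
      have hY : gradY a p * t ^ b ≤ 2 * a * t ^ (a * b) := by
        have := gradY_mul ha0 p
        rw [hp1, hya] at this
        calc gradY a p * t ^ b ≤ gradY a p * y t := by gcongr
          _ = a * (t ^ (a * b) + t ^ (d * b)) := this
          _ ≤ a * (t ^ (a * b) + t ^ (a * b)) := by gcongr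
          _ = _ := by ring
      change ‖(|gradX b c d p| + |gradY a p|) * (|t ^ b| + |y t|)‖ ≤ _
      rw [abs_of_nonneg hX0, abs_of_nonneg hY0, abs_of_pos htb, abs_of_pos hyp,
        Real.norm_of_nonneg (by positivity), Real.norm_of_nonneg hta.le]
      calc (gradX b c d p + gradY a p) * (t ^ b + y t)
            ≤ (gradX b c d p + gradY a p) * (t ^ b + 2 * t ^ b) := by gcongr
        _ = 3 * (gradX b c d p * t ^ b + gradY a p * t ^ b) := by ring
        _ ≤ 3 * ((c + d) * t ^ (a * b) + 2 * a * t ^ (a * b)) := by gcongr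
        _ = _ := by ring
    · filter_upwards [self_mem_nhdsWithin] with t ht
      simp only [Function.comp, gradX_mul hc hd, gradY_mul ha0]
      simp only [Matrix.cons_val]
      rw [hz, hx, (hy t ht).2]
      ring
  have h2 : (fun t : ℝ => ((d : ℝ) - a) * t ^ (d * b)) =o[𝓝[>] 0] fun t : ℝ => t ^ (a * b) := by
    rcases had.eq_or_lt with rfl | had
    · simp
    · exact (((isLittleO_pow_pow (Nat.mul_lt_mul_of_pos_right had hb)).mono
        nhdsWithin_le_nhds).const_mul_left _)
  have h3 : (fun t : ℝ => ((c : ℝ) - a) * t ^ (a * b)) =o[𝓝[>] 0] fun t : ℝ => t ^ (a * b) :=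
    (h1.sub h2).congr_left fun t => by ring
  have hca' : (c : ℝ) - a ≠ 0 := by
    have : (c : ℝ) < a := by exact_mod_cast hca
    linarith
  refine isLittleO_irrefl (Eventually.frequently ?_) ((isLittleO_const_mul_left_iff hca').1 h3)
  filter_upwards [self_mem_nhdsWithin] with t ht using (pow_pos ht _).ne'

theorem isBigO_pow_pow_nhdsGT {m n : ℕ} (h : m ≤ n) :
    (fun t : ℝ => t ^ n) =O[𝓝[>] 0] fun t : ℝ => t ^ m := by
  rcases h.eq_or_lt with rfl | h
  · exact isBigO_refl _ _
  · exact ((isLittleO_pow_pow h).mono nhdsWithin_le_nhds).isBigO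

/-- The curve `x = t^b`, `z = t^(d-c)` balances the two terms: `z^b x^c = x^d` and `y^a = 2 t^(b
d)`. There `gradZ` has order `t^(b d - (d - c))`; it dominates `gradX`, of order `t^(b d - b)`,
because `b + c ≤ d`, and `gradY`, of order `t^(b d - b d / a)`, because `b d ≤ a (d - c)`. -/
theorem not_isBRegularAt_of_add_le (ha : 0 < a) (hb : 0 < b) (hc : 0 < c) (hdb : b + c ≤ d)
    (h : b * d ≤ a * (d - c)) :
    ¬ IsBRegularAt (surface a b c d \ zAxis) zAxis 0 := by
  have hd : 0 < d := by omega
  rw [isBRegularAt_stratum_iff ha hb hc hd]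
  rintro ⟨h1, -⟩
  have hdb0 : d * b ≠ 0 := (mul_pos hd hb).ne'
  obtain ⟨y, hy0, hy⟩ := exists_pow_eq ha (fun t => 2 * t ^ (d * b))
    (fun t ht => by positivity) (by simpa using (tendsto_pow_nhdsGT hdb0).const_mul 2)
  have hz : ∀ t : ℝ, (t ^ (d - c)) ^ b * (t ^ b) ^ c = t ^ (d * b) := fun t => by
    rw [← pow_mul, ← pow_mul, ← pow_add, mul_comm b c, ← add_mul, Nat.sub_add_cancel (by omega)]
  have hx : ∀ t : ℝ, (t ^ b) ^ d = t ^ (d * b) := fun t => by rw [← pow_mul, mul_comm]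
  have hφ := tendsto_curve (b := b) ha hc hd (tendsto_pow_nhdsGT hb.ne') hy0
    (tendsto_pow_nhdsGT (show d - c ≠ 0 by omega)) (fun t ht => (pow_pos ht b).ne')
    (fun t ht => by rw [(hy t ht).2, hz, hx]; ring)
  set φ : ℝ → EuclideanSpace ℝ (Fin 3) := fun t => !₂[t ^ b, y t, t ^ (d - c)]
  obtain ⟨k, rfl⟩ := Nat.exists_eq_add_of_le hdb
  have hs : b + c + k - c = b + k := by omega
  rw [hs] at h
  have hZ : (fun t : ℝ => t ^ ((b + k) * (b - 1) + b * c)) =O[𝓝[>] 0] (gradZ b c ∘ φ) := by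
    have hb' : (b : ℝ) ≠ 0 := by positivity
    refine IsBigO.of_const_mul_right (c := (b : ℝ)⁻¹) ?_
    refine (isBigO_refl _ _).congr_right fun t => ?_
    simp only [Function.comp, gradZ, φ, Matrix.cons_val, hs]
    rw [← pow_mul, ← pow_mul, pow_add]
    field_simp
  have hX : (gradX b c (b + c + k) ∘ φ) =O[𝓝[>] 0] (gradZ b c ∘ φ) := by
    refine IsBigO.trans ?_ hZ
    refine (((isBigO_pow_pow_nhdsGT (m := (b + k) * (b - 1) + b * c)
      (n := b * (b + c + k - 1)) ?_).const_mul_left (c + (b + c + k : ℕ) : ℝ))).congr_left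
      fun t => ?_
    · obtain ⟨b, rfl⟩ := Nat.exists_eq_succ_of_ne_zero hb.ne'
      rw [show b.succ + c + k - 1 = b + c + k by omega, Nat.succ_sub_one, Nat.succ_eq_add_one]
      nlinarith
    · simp only [Function.comp, gradX, φ, Matrix.cons_val, hs]
      have e1 : (t ^ (b + k)) ^ b * (t ^ b) ^ (c - 1) = t ^ (b * (b + c + k - 1)) := by
        rw [← pow_mul, ← pow_mul, ← pow_add]
        congr 1
        rw [show b + c + k - 1 = b + k + (c - 1) by omega]
        ring
      rw [mul_assoc, e1, ← pow_mul]
      ring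
  have hY : (gradY a ∘ φ) =O[𝓝[>] 0] (gradZ b c ∘ φ) := by
    refine IsBigO.trans ?_ hZ
    refine IsBigO.const_mul_left (f := fun t => y t ^ (a - 1)) ?_ _
    -- Only `y^a` is explicit, so the comparison is made between `a`-th powers.
    refine IsBigO.of_pow ha.ne' ?_
    have h2 := (isBigO_pow_pow_nhdsGT (m := ((b + k) * (b - 1) + b * c) * a)
      (n := (b + c + k) * b * (a - 1)) ?_).const_mul_left (2 ^ (a - 1))
    · refine h2.congr' ?_ ?_
      · filter_upwards [self_mem_nhdsWithin] with t ht
        rw [Pi.pow_apply, ← pow_mul, mul_comm (a - 1), pow_mul (y t), (hy t ht).2, mul_pow,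
          ← pow_mul]
      · exact .of_forall fun t => by simp [pow_mul]
    · obtain ⟨b, rfl⟩ := Nat.exists_eq_succ_of_ne_zero hb.ne'
      obtain ⟨a, rfl⟩ := Nat.exists_eq_succ_of_ne_zero ha.ne'
      simp only [Nat.succ_sub_one, Nat.succ_eq_add_one] at *
      nlinarith
  have h2 := (h1.comp_tendsto hφ).trans_isBigO (hX.abs_left.add hY.abs_left)
  refine isLittleO_irrefl (Eventually.frequently ?_) h2
  filter_upwards [self_mem_nhdsWithin] with t ht
  have ht : 0 < t := ht
  have : 0 < gradZ b c (φ t) := by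
    simp only [gradZ, φ, Matrix.cons_val]
    positivity
  exact this.ne'

end NotRegular

end Whitney

end

/-! ### The classification assembled -/

/-- Classification of Whitney (b)-regularity at `0` of `(V - Oz, Oz)`, for
`V = {y^a = z^b x^c + x^d}` in `ℝ³`. -/
theorem mainTheorem1 (a b c d : ℕ) (ha : 0 < a) (hb : 0 < b) (hc : 0 < c) (hd : 0 < d) :
    Whitney.IsSmoothSubmanifold 2 (Whitney.surface a b c d \ Whitney.zAxis) ∧
    Whitney.IsSmoothSubmanifold 1 Whitney.zAxis ∧
    (0 : EuclideanSpace ℝ (Fin 3)) ∈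
      Whitney.zAxis ∩ closure (Whitney.surface a b c d \ Whitney.zAxis) ∧
    (Whitney.IsBRegularAt (Whitney.surface a b c d \ Whitney.zAxis) Whitney.zAxis 0 ↔
      a = 1 ∨
      (1 < a ∧ d ≤ c) ∨
      (1 < a ∧ c < d ∧ b ≡ 0 [MOD 2] ∧ d ≡ c [MOD 2] ∧
        ((d < a ∧ d < b + c) ∨
         (a ≤ d ∧ a ≤ c ∧
           (d < b + c ∨
            (b + c ≤ d ∧
              (a ≤ b ∨
               (b < a ∧ (d : ℝ) < (a : ℝ) * c / ((a : ℝ) - b))))))))) := by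
  refine ⟨Whitney.isSmoothSubmanifold_stratum ha hb hc hd, Whitney.isSmoothSubmanifold_zAxis,
    Whitney.zero_mem_zAxis_inter_closure ha hc hb hd, ?_⟩
  -- Clearing the denominator gives `(a - b) d < a c`; subtracting `(a - b) c` from both sides gives
  -- the form used by the inequalities.
  have hdiv : b < a → c < d → ((d : ℝ) < (a : ℝ) * c / ((a : ℝ) - b) ↔
      (a - b) * (d - c) < b * c) := by
    intro hba hcd
    have h1 : (0 : ℝ) < (a : ℝ) - b := sub_pos.2 (by exact_mod_cast hba)
    rw [lt_div_iff₀ h1, ← Nat.cast_lt (α := ℝ)]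
    push_cast [Nat.cast_sub hba.le, Nat.cast_sub hcd.le]
    constructor <;> intro h <;> nlinarith
  constructor
  · intro h
    by_cases ha1 : a = 1
    · exact .inl ha1
    have ha1 : 1 < a := by omega
    by_cases hdc : d ≤ c
    · exact .inr (.inl ⟨ha1, hdc⟩)
    have hcd : c < d := by omega
    have hbe : ¬ Odd b := fun ho => Whitney.not_isBRegularAt_of_odd ha1 hb hc hcd (.inl ho) h
    have hde : ¬ Odd (d - c) := fun ho =>
      Whitney.not_isBRegularAt_of_odd ha1 hb hc hcd (.inr ho) h
    rw [Nat.not_odd_iff_even, Nat.even_iff] at hbe hde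
    refine .inr (.inr ⟨ha1, hcd, hbe, by unfold Nat.ModEq; omega, ?_⟩)
    have hadd : b + c ≤ d → a * (d - c) < b * d := fun hle => by
      by_contra! hcon
      exact Whitney.not_isBRegularAt_of_add_le ha hb hc hle hcon h
    by_cases had : d < a
    · refine .inl ⟨had, ?_⟩
      by_contra! hle
      have h1 := hadd hle
      -- For `d < a` and `b + c ≤ d` the second hypothesis of the counterexample is automatic, which
      -- is why this branch has no further subdivision.
      have h2 : d * b ≤ a * (d - c) := Nat.mul_le_mul had.le (by omega)
      linarith [mul_comm d b]
    · have hac : a ≤ c := by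
        by_contra! hca
        exact Whitney.not_isBRegularAt_of_lt_of_le hb hc hca (by omega) h
      refine .inr ⟨by omega, hac, ?_⟩
      by_cases hdb : d < b + c
      · exact .inl hdb
      refine .inr ⟨by omega, ?_⟩
      by_cases hab : a ≤ b
      · exact .inl hab
      refine .inr ⟨by omega, (hdiv (by omega) hcd).2 ?_⟩
      have h1 := hadd (by omega)
      zify [show b ≤ a by omega, hcd.le] at h1 ⊢
      linarith
  · rintro (rfl | ⟨ha1, hdc⟩ | ⟨ha1, hcd, hbe, hde, h⟩)
    · exact Whitney.isBRegularAt_of_eq_one hb hc hd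
    · exact Whitney.isBRegularAt_of_le ha1 hb hd hdc
    · have hbe' : Even b := Nat.even_iff.2 hbe
      have hde' : Even (d - c) := by
        rw [Nat.even_iff]
        unfold Nat.ModEq at hde
        omega
      rw [Whitney.isBRegularAt_stratum_iff ha hb hc hd]
      refine ⟨?_, Whitney.isLittleO_radial_of_even ha hb hc hcd hbe' hde' (by omega)⟩
      by_cases hdb : d < b + c
      · exact Whitney.isLittleO_gradZ_of_lt_add ha hc hcd hb hbe' hde' hdb
      · refine Whitney.isLittleO_gradZ_of_mul_lt ha hc hcd hb hbe' hde' ?_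
        rcases h with h | ⟨-, -, h | ⟨-, h | ⟨h1, h2⟩⟩⟩
        · omega
        · omega
        · exact .inl h
        · exact .inr ⟨h1, (hdiv h1 hcd).1 h2⟩
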